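/- The two-dimensional Sierpinski gasket $SG(n)$, $n\ge 0$, is the following graph, with vertices written in triangular-lattice coordinates $(i,j)\in\mathbb{N}^2$. $SG(0)$ is the triangle with vertices $(0,0),(1,0),(0,1)$, and $SG(n+1)$ is the union of $SG(n)$ and of its two translates by $(2^n,0)$ and $(0,2^n)$. For $n\ge 0$ put $a_n=(2^n,0)$, $b_n=(0,2^n)$ and $c_n=(2^n,2^n)$; thus $a_n,b_n$ are the outmost vertices of $SG(n)$ other than $(0,0)$, and $a_n,b_n,c_n$ are the three points at which the three copies of $SG(n)$ in $SG(n+1)$ meet. For a vertex $x$ of $SG(n)$ and $j\in\{1,2,3,4\}$ let $$F_j(n,x)=\frac{f_j(n,x)}{f(n)},$$ where $f(n)$ is the number of spanning trees of $SG(n)$ and $f_j(n,x)$ is the number of those spanning trees in which $x$ has degree exactly $j$. Let $m\ge 0$ be an integer and, for every $n\ge 0$, let $x_n$ be any one of the vertices $a_n,b_n,c_n$, regarded as a vertex of $SG(n+m+1)$. Then $$\lim_{n\to\infty}F_1(n+m+1,x_n)=0,\qquad \lim_{n\to\infty}F_2(n+m+1,x_n)=\frac{121}{196},$$ $$\lim_{n\to\infty}F_3(n+m+1,x_n)=\frac{33}{98},\qquad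 \lim_{n\to\infty}F_4(n+m+1,x_n)=\frac{9}{196}.$$ -/

import Mathlib

open Filter Topology

namespace SierpinskiGasket

/-- Vertices of the stage-`n` gasket, in the coordinates `(i, j)` of a triangular lattice (the
two coordinate axes point along two sides of the gasket at its leftmost corner `(0, 0)`).
Stage `0` is a triangle; stage `n + 1` is the union of stage `n` and of its translates by
`(2 ^ n, 0)` and `(0, 2 ^ n)`. -/
def verts : ℕ → Finset (ℕ × ℕ)
  | 0 => {(0, 0), (1, 0), (0, 1)}
  | n + 1 => verts n ∪ (verts n).map (addRightEmbedding (2 ^ n, 0)) ∪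
      (verts n).map (addRightEmbedding (0, 2 ^ n))

/-- The bonds of the stage-`n` gasket, as a graph on the whole lattice. -/
def bonds : ℕ → SimpleGraph (ℕ × ℕ)
  | 0 => SimpleGraph.fromEdgeSet
      {s((0, 0), (1, 0)), s((0, 0), (0, 1)), s((1, 0), (0, 1))}
  | n + 1 => bonds n ⊔ (bonds n).map (addRightEmbedding (2 ^ n, 0)) ⊔
      (bonds n).map (addRightEmbedding (0, 2 ^ n))

/-- The vertex set `V(SG(n))` as a type. -/
abbrev Vertex (n : ℕ) : Type := {p : ℕ × ℕ // p ∈ verts n}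

/-- The two-dimensional Sierpinski gasket `SG(n)`. -/
def SG (n : ℕ) : SimpleGraph (Vertex n) := (bonds n).comap Subtype.val

/-- `T` is a spanning tree of `G`. -/
def IsSpanningTree {V : Type*} (G T : SimpleGraph V) : Prop := T ≤ G ∧ T.IsTree

/-- `f(n)`: the number of spanning trees of `SG(n)`. -/
noncomputable def numTrees (n : ℕ) : ℕ :=
  {T : SimpleGraph (Vertex n) | IsSpanningTree (SG n) T}.ncard

open Classical in
/-- `f_j(n, x)`: the number of spanning trees of `SG(n)` with exactly `j` bonds at `x`. -/
noncomputable def numTreesDeg (j n : ℕ) (x : Vertex n) : ℕ :=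
  {T : SimpleGraph (Vertex n) | IsSpanningTree (SG n) T ∧ T.degree x = j}.ncard

/-- `F_j(n, x) = f_j(n, x) / f(n)`. -/
noncomputable def degProb (j n : ℕ) (x : Vertex n) : ℝ :=
  (numTreesDeg j n x : ℝ) / (numTrees n : ℝ)

theorem verts_mono {m n : ℕ} (h : m ≤ n) : verts m ⊆ verts n := by
  induction n, h using Nat.le_induction with
  | base => exact Finset.Subset.refl _
  | succ n _ ih =>
    intro p hp
    simp only [verts, Finset.mem_union]
    exact Or.inl (Or.inl (ih hp))

theorem corners_mem (n : ℕ) :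
    (0, 0) ∈ verts n ∧ (2 ^ n, 0) ∈ verts n ∧ (0, 2 ^ n) ∈ verts n := by
  induction n with
  | zero => simp [verts]
  | succ n ih =>
    obtain ⟨h0, h1, h2⟩ := ih
    refine ⟨?_, ?_, ?_⟩
    · simp only [verts, Finset.mem_union]
      exact Or.inl (Or.inl h0)
    · simp only [verts, Finset.mem_union]
      refine Or.inl (Or.inr (Finset.mem_map.2 ⟨(2 ^ n, 0), h1, ?_⟩))
      simp [pow_succ, mul_two]
    · simp only [verts, Finset.mem_union]
      refine Or.inr (Finset.mem_map.2 ⟨(0, 2 ^ n), h2, ?_⟩)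
      simp [pow_succ, mul_two]

theorem mid_mem (n : ℕ) : (2 ^ n, 2 ^ n) ∈ verts (n + 1) := by
  simp only [verts, Finset.mem_union]
  refine Or.inr (Finset.mem_map.2 ⟨(2 ^ n, 0), (corners_mem n).2.1, ?_⟩)
  simp

/-- `a_n`, the rightmost vertex of `SG(n)`, as a vertex of `SG(n + m + 1)`. -/
def vertexA (n m : ℕ) : Vertex (n + m + 1) :=
  ⟨(2 ^ n, 0), verts_mono (by omega) (corners_mem n).2.1⟩

/-- `b_n`, the topmost vertex of `SG(n)`, as a vertex of `SG(n + m + 1)`. -/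
def vertexB (n m : ℕ) : Vertex (n + m + 1) :=
  ⟨(0, 2 ^ n), verts_mono (by omega) (corners_mem n).2.2⟩

/-- `c_n`, the third vertex of the largest lacunary triangle of `SG(n + 1)` (its other two
vertices are `a_n` and `b_n`), as a vertex of `SG(n + m + 1)`. -/
def vertexC (n m : ℕ) : Vertex (n + m + 1) :=
  ⟨(2 ^ n, 2 ^ n), verts_mono (by omega) (mid_mem n)⟩

end SierpinskiGasket

/-! A subgraph of `SG(n + 1)` is a triple of subgraphs of the three copies of `SG(n)`. Consider the
forests each of whose components contains an outmost vertex, and record which of the three outmost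
vertices they connect: this pattern is determined by the three patterns on the copies, so counting
forests with given patterns is a finite recursion. It preserves the proportions
`1 : 1 : 1 : 1 : 3` of the five counts, up to a factor that is geometric in the number of
components. Hence, given the pattern on `SG(n + 1)`, the law of the patterns on the copies does not
depend on `n`, and the degree of an outmost vertex is governed by powers of a fixed stochastic
matrix. Its stationary law `(18, 5, 5) / 28` gives this degree the limit law `11/14, 3/14` on
`{1, 2}` whatever the pattern. The degrees of a vertex `a_n`, `b_n` or `c_n` in the two copies that
meet there are therefore asymptotically independent, and the limit law is the convolution square;
enlarging the gasket further only averages over patterns. -/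

namespace SierpinskiGasket

open scoped BigOperators Matrix

section EdgeCount

theorem ncard_edgeSet_map {V W : Type*} (f : V ↪ W) (G : SimpleGraph V) :
    (G.map f).edgeSet.ncard = G.edgeSet.ncard := by
  rw [SimpleGraph.edgeSet_map, Set.ncard_image_of_injective _ f.sym2Map.injective]

theorem ncard_edgeSet_iSup {ι V : Type*} [Fintype ι] [Finite V] {G : ι → SimpleGraph V}
    (hG : Pairwise (Function.onFun Disjoint G)) :
    (⨆ i, G i).edgeSet.ncard = ∑ i, (G i).edgeSet.ncard := by
  rw [SimpleGraph.edgeSet_iSup, Set.ncard_iUnion_of_finite (fun i => Set.toFinite _)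
    fun i j hij => SimpleGraph.disjoint_edgeSet.2 (hG hij), finsum_eq_sum_of_fintype]

variable {V : Type*} {G : SimpleGraph V}

theorem iSup_spanningCoe_toSimpleGraph (G : SimpleGraph V) :
    ⨆ c : G.ConnectedComponent, c.toSimpleGraph.spanningCoe = G := by
  ext v w
  simp only [SimpleGraph.iSup_adj, SimpleGraph.ConnectedComponent.adj_spanningCoe_toSimpleGraph]
  exact ⟨fun ⟨_, _, h⟩ => h, fun h => ⟨G.connectedComponentMk v, rfl, h⟩⟩

theorem pairwise_disjoint_spanningCoe_toSimpleGraph (G : SimpleGraph V) :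
    Pairwise (Function.onFun Disjoint
      fun c : G.ConnectedComponent => c.toSimpleGraph.spanningCoe) := by
  refine fun c d hcd => SimpleGraph.disjoint_left.2 fun v w hc hd => hcd ?_
  rw [SimpleGraph.ConnectedComponent.adj_spanningCoe_toSimpleGraph] at hc hd
  exact hc.1.symm.trans hd.1

theorem ncard_edgeSet_eq_sum_connectedComponent [Finite V] (G : SimpleGraph V)
    [Fintype G.ConnectedComponent] :
    G.edgeSet.ncard = ∑ c : G.ConnectedComponent, c.toSimpleGraph.edgeSet.ncard := by
  conv_lhs => rw [← iSup_spanningCoe_toSimpleGraph G]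
  rw [ncard_edgeSet_iSup (pairwise_disjoint_spanningCoe_toSimpleGraph G)]
  exact Finset.sum_congr rfl fun c _ => ncard_edgeSet_map _ _

theorem card_eq_sum_card_connectedComponent [Finite V] (G : SimpleGraph V)
    [Fintype G.ConnectedComponent] :
    Nat.card V = ∑ c : G.ConnectedComponent, Nat.card c.supp := by
  rw [← Set.ncard_univ, ← G.iUnion_connectedComponentSupp,
    Set.ncard_iUnion_of_finite (fun _ => Set.toFinite _)
      G.pairwise_disjoint_supp_connectedComponent, finsum_eq_sum_of_fintype]
  rfl

theorem ncard_edgeSet_add_card_connectedComponent [Finite V] (hG : G.IsAcyclic) :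
    G.edgeSet.ncard + Nat.card G.ConnectedComponent = Nat.card V := by
  have := Fintype.ofFinite G.ConnectedComponent
  rw [ncard_edgeSet_eq_sum_connectedComponent, card_eq_sum_card_connectedComponent G,
    Nat.card_eq_fintype_card, ← Finset.card_univ, Finset.card_eq_sum_ones,
    ← Finset.sum_add_distrib]
  refine Finset.sum_congr rfl fun c _ => ?_
  exact (SimpleGraph.isTree_iff_connected_and_card.1 (hG.isTree_connectedComponent c)).2

theorem isAcyclic_iff_ncard_edgeSet_add_card_connectedComponent [Finite V] :
    G.IsAcyclic ↔ G.edgeSet.ncard + Nat.card G.ConnectedComponent = Nat.card V := by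
  refine ⟨ncard_edgeSet_add_card_connectedComponent, fun hG => ?_⟩
  obtain ⟨F, hFG, hF, hreach⟩ := G.exists_isAcyclic_reachable_eq_le
  have hcomp : Nat.card F.ConnectedComponent = Nat.card G.ConnectedComponent := by
    simp only [SimpleGraph.ConnectedComponent, hreach]
  have hcount := ncard_edgeSet_add_card_connectedComponent hF
  have hedges : F.edgeSet = G.edgeSet :=
    Set.eq_of_subset_of_ncard_le (SimpleGraph.edgeSet_mono hFG) (by omega)
  exact SimpleGraph.edgeSet_injective hedges ▸ hF

end EdgeCount

section Limits

theorem tendsto_of_forall_exists_eq {ι α β : Type*} [Finite ι] {f : ι → α → β} {g : α → β}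
    {l : Filter α} {l' : Filter β} (hf : ∀ i, Tendsto (f i) l l')
    (hg : ∀ x, ∃ i, g x = f i x) : Tendsto g l l' := by
  refine tendsto_def.2 fun s hs => ?_
  filter_upwards [eventually_all.2 fun i => (hf i).eventually_mem hs] with x hx
  obtain ⟨i, hi⟩ := hg x
  simpa only [Set.mem_preimage, hi] using hx i

variable {ι : Type*} [Fintype ι] [DecidableEq ι] {P : Matrix ι ι ℝ} {o : ι}

theorem le_mulVec_of_rowStochastic (hP : P ∈ Matrix.rowStochastic ℝ ι) {c a : ℝ} {i : ι}
    (hc : c ≤ P i o) {v : ι → ℝ} (hv : ∀ j, a ≤ v j) : (1 - c) * a + c * v o ≤ (P *ᵥ v) i := by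
  have hterm : P i o * (v o - a) ≤ ∑ j, P i j * (v j - a) :=
    Finset.single_le_sum (f := fun j => P i j * (v j - a))
      (fun j _ => mul_nonneg (hP.1 i j) (sub_nonneg.2 (hv j))) (Finset.mem_univ o)
  have hsum : ∑ j, P i j * (v j - a) = (P *ᵥ v) i - a := by
    simp only [mul_sub, Finset.sum_sub_distrib, ← Finset.sum_mul,
      Matrix.sum_row_of_mem_rowStochastic hP, one_mul, Matrix.mulVec, dotProduct]
  nlinarith [mul_le_mul_of_nonneg_right hc (sub_nonneg.2 (hv o))]

theorem mulVec_le_of_rowStochastic (hP : P ∈ Matrix.rowStochastic ℝ ι) {c b : ℝ} {i : ι}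
    (hc : c ≤ P i o) {v : ι → ℝ} (hv : ∀ j, v j ≤ b) : (P *ᵥ v) i ≤ (1 - c) * b + c * v o := by
  have h := le_mulVec_of_rowStochastic hP hc (v := -v) fun j => neg_le_neg (hv j)
  rw [Matrix.mulVec_neg] at h
  simp only [Pi.neg_apply] at h
  linarith

theorem abs_sub_le_of_mulVec_recursion (hP : P ∈ Matrix.rowStochastic ℝ ι) {c : ℝ}
    (hc : ∀ i, c ≤ P i o) {u : ℕ → ι → ℝ} (hu : ∀ n, u (n + 1) = P *ᵥ u n) (n : ℕ) (i j : ι) :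
    |u n i - u n j| ≤ (1 - c) ^ n * (2 * ‖u 0‖) := by
  suffices h : ∃ a, ∀ k, a ≤ u n k ∧ u n k ≤ a + (1 - c) ^ n * (2 * ‖u 0‖) by
    obtain ⟨a, ha⟩ := h
    exact abs_sub_le_iff.2 ⟨by linarith [ha i, ha j], by linarith [ha i, ha j]⟩
  induction n with
  | zero =>
    refine ⟨-‖u 0‖, fun k => ?_⟩
    have hk := abs_le.1 (norm_le_pi_norm (u 0) k)
    exact ⟨hk.1, by linarith⟩
  | succ n ih =>
    obtain ⟨a, ha⟩ := ih
    refine ⟨(1 - c) * a + c * u n o, fun k => ?_⟩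
    rw [hu, pow_succ]
    exact ⟨le_mulVec_of_rowStochastic hP (hc k) fun j => (ha j).1,
      (mulVec_le_of_rowStochastic hP (hc k) fun j => (ha j).2).trans_eq (by ring)⟩

/-- Doeblin's argument: each step shrinks the spread of `u n` over the states by the factor
`1 - c`, where `c` is the least entry of the column `o`, and does not change `π ⬝ᵥ u n`. -/
theorem tendsto_of_rowStochastic_of_column_pos (hP : P ∈ Matrix.rowStochastic ℝ ι)
    (ho : ∀ i, 0 < P i o) {π : ι → ℝ} (hπP : π ᵥ* P = π) (hπ : ∑ i, π i = 1) {u : ℕ → ι → ℝ}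
    (hu : ∀ n, u (n + 1) = P *ᵥ u n) (i : ι) :
    Tendsto (fun n => u n i) atTop (𝓝 (π ⬝ᵥ u 0)) := by
  obtain ⟨k, -, hk⟩ := Finset.exists_min_image Finset.univ (P · o) ⟨i, Finset.mem_univ i⟩
  have hinv (n : ℕ) : π ⬝ᵥ u n = π ⬝ᵥ u 0 := by
    induction n with
    | zero => rfl
    | succ n ih => rw [hu, Matrix.dotProduct_mulVec, hπP, ih]
  have hdiff (n : ℕ) : u n i - π ⬝ᵥ u 0 = ∑ j, π j * (u n i - u n j) := by
    rw [← hinv n]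
    simp only [mul_sub, Finset.sum_sub_distrib, ← Finset.sum_mul, hπ, one_mul, dotProduct]
  have hbound (n : ℕ) :
      ‖u n i - π ⬝ᵥ u 0‖ ≤ ∑ j, |π j| * ((1 - P k o) ^ n * (2 * ‖u 0‖)) := by
    rw [hdiff]
    refine norm_sum_le_of_le _ fun j _ => ?_
    rw [norm_mul]
    gcongr
    exacts [le_rfl, abs_sub_le_of_mulVec_recursion hP (fun l => hk l (Finset.mem_univ l)) hu n i j]
  have hpow : Tendsto (fun n => (1 - P k o) ^ n) atTop (𝓝 0) :=
    tendsto_pow_atTop_nhds_zero_of_lt_one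
      (sub_nonneg.2 (Matrix.le_one_of_mem_rowStochastic hP)) (sub_lt_self 1 (ho k))
  refine tendsto_sub_nhds_zero_iff.1 (squeeze_zero_norm hbound ?_)
  simpa using tendsto_finsetSum Finset.univ fun j _ =>
    (hpow.mul_const (2 * ‖u 0‖)).const_mul |π j|

end Limits

/-- A presentation of `W` as a union of copies of `V`, one for each index, in which distinct copies
`i` and `j` meet in a single vertex: the corner `j` of copy `i`, which is the corner `i` of
copy `j`. -/
structure CornerGluing (ι V W : Type*) where
  corner : ι ↪ V
  copy : ι → V ↪ W
  copy_corner_comm (i j : ι) : copy i (corner j) = copy j (corner i)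
  eq_corner_of_copy_eq {i j : ι} {v w : V} : i ≠ j → copy i v = copy j w → v = corner j
  exists_copy_eq (w : W) : ∃ i v, copy i v = w

namespace CornerGluing

variable {ι V W : Type*} (C : CornerGluing ι V W)

/-- The graph on `W` assembled from one graph on each copy of `V`. -/
def glue (S : ι → SimpleGraph V) : SimpleGraph W := ⨆ i, (S i).map (C.copy i)

/-- The part of a graph on `W` lying on the copy `i` of `V`. -/
def piece (G : SimpleGraph W) (i : ι) : SimpleGraph V := G.comap (C.copy i)

variable {C} {S : ι → SimpleGraph V} {G : SimpleGraph W} {i j : ι} {v w : V}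

theorem copy_eq_copy_iff (hij : i ≠ j) :
    C.copy i v = C.copy j w ↔ v = C.corner j ∧ w = C.corner i := by
  refine ⟨fun h => ⟨C.eq_corner_of_copy_eq hij h, C.eq_corner_of_copy_eq hij.symm h.symm⟩, ?_⟩
  rintro ⟨rfl, rfl⟩
  exact C.copy_corner_comm i j

theorem glue_adj {a b : W} :
    (C.glue S).Adj a b ↔ ∃ i v w, (S i).Adj v w ∧ C.copy i v = a ∧ C.copy i w = b := by
  simp only [glue, SimpleGraph.iSup_adj, SimpleGraph.map_adj]

theorem glue_adj_copy_iff {a : W} : (C.glue S).Adj (C.copy i v) a ↔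
    (∃ w, (S i).Adj v w ∧ C.copy i w = a) ∨
      ∃ j, j ≠ i ∧ v = C.corner j ∧ ∃ w, (S j).Adj (C.corner i) w ∧ C.copy j w = a := by
  rw [glue_adj]
  constructor
  · rintro ⟨j, v', w, hadj, hv, rfl⟩
    rcases eq_or_ne j i with rfl | hji
    · exact Or.inl ⟨w, (C.copy j).injective hv ▸ hadj, rfl⟩
    · obtain ⟨rfl, rfl⟩ := (copy_eq_copy_iff hji).1 hv
      exact Or.inr ⟨j, hji, rfl, w, hadj, rfl⟩
  · rintro (⟨w, hadj, rfl⟩ | ⟨j, -, rfl, w, hadj, rfl⟩)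
    · exact ⟨i, v, w, hadj, rfl, rfl⟩
    · exact ⟨j, C.corner i, w, hadj, C.copy_corner_comm j i, rfl⟩

theorem piece_glue : C.piece (C.glue S) = S := by
  funext i
  ext v w
  change (C.glue S).Adj (C.copy i v) (C.copy i w) ↔ _
  rw [glue_adj_copy_iff]
  constructor
  · rintro (⟨w', hadj, hw⟩ | ⟨j, hji, rfl, w', hadj, hw⟩)
    · exact (C.copy i).injective hw ▸ hadj
    · exact absurd ((copy_eq_copy_iff hji).1 hw).1.symm hadj.ne
  · exact fun hadj => Or.inl ⟨w, hadj, rfl⟩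

theorem glue_injective : Function.Injective C.glue :=
  Function.LeftInverse.injective fun _ => piece_glue

theorem glue_piece (hG : G ≤ C.glue S) : C.glue (C.piece G) = G := by
  ext a b
  rw [glue_adj]
  constructor
  · rintro ⟨i, v, w, hadj, rfl, rfl⟩
    exact hadj
  · intro hadj
    obtain ⟨i, v, w, -, rfl, rfl⟩ := glue_adj.1 (hG hadj)
    exact ⟨i, v, w, hadj, rfl, rfl⟩

theorem glue_le_glue_iff {T : ι → SimpleGraph V} : C.glue S ≤ C.glue T ↔ S ≤ T := by
  refine ⟨fun h i => ?_, fun h => iSup_mono fun i => SimpleGraph.map_monotone _ (h i)⟩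
  have hi := SimpleGraph.comap_monotone (C.copy i) h
  change C.piece _ i ≤ C.piece _ i at hi
  rwa [piece_glue, piece_glue] at hi

theorem pairwise_disjoint_map_copy :
    Pairwise (Function.onFun Disjoint fun i => (S i).map (C.copy i)) := by
  refine fun i j hij => SimpleGraph.disjoint_left.2 fun a b hi hj => ?_
  obtain ⟨v, w, hadj, rfl, rfl⟩ := (SimpleGraph.map_adj _ _ _ _).1 hi
  obtain ⟨v', w', -, hv, hw⟩ := (SimpleGraph.map_adj _ _ _ _).1 hj
  exact hadj.ne (((copy_eq_copy_iff hij).1 hv.symm).1.trans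
    ((copy_eq_copy_iff hij).1 hw.symm).1.symm)

theorem ncard_edgeSet_glue [Fintype ι] [Finite W] :
    (C.glue S).edgeSet.ncard = ∑ i, (S i).edgeSet.ncard := by
  rw [glue, ncard_edgeSet_iSup pairwise_disjoint_map_copy]
  exact Finset.sum_congr rfl fun i _ => ncard_edgeSet_map _ _

theorem ncard_neighborSet_glue_of_forall_ne (hv : ∀ j ≠ i, v ≠ C.corner j) :
    ((C.glue S).neighborSet (C.copy i v)).ncard = ((S i).neighborSet v).ncard := by
  have h : (C.glue S).neighborSet (C.copy i v) = C.copy i '' (S i).neighborSet v := by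
    ext a
    simp only [SimpleGraph.mem_neighborSet, glue_adj_copy_iff, Set.mem_image]
    exact or_iff_left fun ⟨j, hji, hj, _⟩ => hv j hji hj
  rw [h, Set.ncard_image_of_injective _ (C.copy i).injective]

theorem ncard_neighborSet_glue_corner [Finite V] (hij : i ≠ j) :
    ((C.glue S).neighborSet (C.copy i (C.corner j))).ncard =
      ((S i).neighborSet (C.corner j)).ncard + ((S j).neighborSet (C.corner i)).ncard := by
  have h : (C.glue S).neighborSet (C.copy i (C.corner j)) =
      C.copy i '' (S i).neighborSet (C.corner j) ∪
        C.copy j '' (S j).neighborSet (C.corner i) := by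
    ext a
    simp only [SimpleGraph.mem_neighborSet, glue_adj_copy_iff, Set.mem_union, Set.mem_image,
      C.corner.injective.eq_iff]
    refine or_congr_right ⟨?_, fun hw => ⟨j, hij.symm, rfl, hw⟩⟩
    rintro ⟨_, _, rfl, hw⟩
    exact hw
  rw [h, Set.ncard_union_eq, Set.ncard_image_of_injective _ (C.copy i).injective,
    Set.ncard_image_of_injective _ (C.copy j).injective]
  refine Set.disjoint_left.2 ?_
  rintro _ ⟨v, hv, rfl⟩ ⟨w, -, hw⟩
  exact hv.ne ((copy_eq_copy_iff hij).1 hw.symm).1.symm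

theorem card_add_three_eq [Finite V] (C : CornerGluing (Fin 3) V W) :
    Nat.card W + 3 = 3 * Nat.card V := by
  have hcover : Set.range (C.copy 0) ∪ Set.range (C.copy 1) ∪ Set.range (C.copy 2) = Set.univ := by
    refine Set.eq_univ_of_forall fun w => ?_
    obtain ⟨i, v, rfl⟩ := C.exists_copy_eq w
    fin_cases i <;> simp
  have hinter {i j : Fin 3} (hij : i ≠ j) :
      Set.range (C.copy i) ∩ Set.range (C.copy j) = {C.copy i (C.corner j)} := by
    ext w
    simp only [Set.mem_inter_iff, Set.mem_range, Set.mem_singleton_iff]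
    constructor
    · rintro ⟨⟨v, rfl⟩, v', hv⟩
      rw [C.eq_corner_of_copy_eq hij hv.symm]
    · rintro rfl
      exact ⟨⟨_, rfl⟩, _, C.copy_corner_comm j i⟩
  have hcard (i : Fin 3) : (Set.range (C.copy i)).ncard = Nat.card V := by
    rw [← Nat.card_coe_set_eq, Nat.card_range_of_injective (C.copy i).injective]
  have h₀₁ := Set.ncard_union_add_ncard_inter (Set.range (C.copy 0)) (Set.range (C.copy 1))
  have h₂ := Set.ncard_union_add_ncard_inter
    (Set.range (C.copy 0) ∪ Set.range (C.copy 1)) (Set.range (C.copy 2))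
  have hne : C.copy 0 (C.corner 2) ≠ C.copy 1 (C.corner 2) := fun h =>
    absurd (C.corner.injective (C.eq_corner_of_copy_eq (by decide) h)) (by decide)
  rw [hinter (by decide), hcard, hcard, Set.ncard_singleton] at h₀₁
  rw [hcover, Set.union_inter_distrib_right, hinter (by decide), hinter (by decide),
    Set.singleton_union, Set.ncard_pair hne, hcard, Set.ncard_univ] at h₂
  omega

end CornerGluing

section Corners

variable {ι V : Type*}

/-- The partition of the corners that the connected components of `T` induce. -/
@[reducible] def cornerSetoid (c : ι → V) (T : SimpleGraph V) : Setoid ι :=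
  T.reachableSetoid.comap c

/-- Every connected component contains a corner. -/
def CornerRooted (c : ι → V) (T : SimpleGraph V) : Prop := ∀ v, ∃ i, T.Reachable (c i) v

theorem cornerSetoid_iff {c : ι → V} {T : SimpleGraph V} {i j : ι} :
    cornerSetoid c T i j ↔ T.Reachable (c i) (c j) := Iff.rfl

theorem CornerRooted.card_connectedComponent {c : ι → V} {T : SimpleGraph V}
    (hT : CornerRooted c T) :
    Nat.card T.ConnectedComponent = Nat.card (Quotient (cornerSetoid c T)) := by
  refine (Nat.card_congr ((Setoid.comapQuotientEquiv c T.reachableSetoid).trans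
    (Equiv.subtypeUnivEquiv fun q => ?_))).symm
  induction q using Quotient.inductionOn with
  | h v => exact (hT v).imp fun i hi => Quotient.sound hi

end Corners

section Route

/-- Given for each of three copies a partition of its corners, there is a path from the outer
corner `x` to the corner `l` of copy `i`, passing through copy `x`, some copy `k` and copy `i`. -/
def Route (R : Fin 3 → Setoid (Fin 3)) (x i l : Fin 3) : Prop :=
  ∃ k, R x x k ∧ R k x i ∧ R i k l

/-- There is a path from the outer corner `x` to the corner `l` of copy `i`, which for `l ≠ i` is
also the corner `i` of copy `l` and may be reached through either copy. -/
def Linked (R : Fin 3 → Setoid (Fin 3)) (x i l : Fin 3) : Prop := Route R x i l ∨ Route R x l i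

variable {R : Fin 3 → Setoid (Fin 3)} {x i l m : Fin 3}

theorem Linked.refl (x : Fin 3) : Linked R x x x :=
  Or.inl ⟨x, (R x).refl x, (R x).refl x, (R x).refl x⟩

theorem Linked.symm (h : Linked R x i l) : Linked R x l i := Or.symm h

theorem Linked.trans (h : Linked R x i l) (hlm : R i l m) : Linked R x i m := by
  rcases h with ⟨k, hxk, hki, hil⟩ | ⟨k, hxk, hkl, hli⟩
  · exact Or.inl ⟨k, hxk, hki, (R i).trans hil hlm⟩
  have hcases : ∀ x i l k m : Fin 3, l = i ∨ k = i ∨ k = l ∨ x = k ∨ x = l ∨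
      x = i ∧ (m = i ∨ m = l ∨ m = k) := by decide
  rcases hcases x i l k m with rfl | rfl | rfl | rfl | rfl | ⟨rfl, rfl | rfl | rfl⟩
  · exact Or.inl ⟨k, hxk, hkl, (R l).trans hli hlm⟩
  · exact Or.inl ⟨x, (R x).refl x, hxk, (R k).trans hkl hlm⟩
  · exact Or.inl ⟨k, hxk, (R k).trans hkl hli, hlm⟩
  · exact Or.inl ⟨l, hkl, hli, hlm⟩
  · exact Or.inl ⟨x, (R x).refl x, (R x).trans hxk hli, hlm⟩
  · exact Linked.refl m
  · exact Or.inr ⟨k, hxk, hkl, hli⟩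
  · exact Or.inl ⟨x, (R x).refl x, (R x).refl x, hxk⟩

end Route

namespace CornerGluing

variable {V W : Type*} (C : CornerGluing (Fin 3) V W)

/-- The corner `i` of copy `i`, which lies on no other copy. -/
def outerCorner (i : Fin 3) : W := C.copy i (C.corner i)

variable {C} {S : Fin 3 → SimpleGraph V}

theorem reachable_copy {i : Fin 3} {v w : V} (h : (S i).Reachable v w) :
    (C.glue S).Reachable (C.copy i v) (C.copy i w) :=
  h.map ⟨C.copy i, fun hadj => glue_adj.2 ⟨i, _, _, hadj, rfl, rfl⟩⟩

theorem reachable_of_route {x i l : Fin 3}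
    (h : Route (fun i => cornerSetoid C.corner (S i)) x i l) :
    (C.glue S).Reachable (C.outerCorner x) (C.copy i (C.corner l)) := by
  obtain ⟨k, hxk, hki, hil⟩ := h
  have hxk := reachable_copy (C := C) hxk
  have hki := reachable_copy (C := C) hki
  rw [C.copy_corner_comm x k] at hxk
  rw [C.copy_corner_comm k i] at hki
  exact hxk.trans (hki.trans (reachable_copy hil))

theorem reachable_of_linked {x i l : Fin 3}
    (h : Linked (fun i => cornerSetoid C.corner (S i)) x i l) :
    (C.glue S).Reachable (C.outerCorner x) (C.copy i (C.corner l)) := by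
  rcases h with h | h
  · exact reachable_of_route h
  · exact C.copy_corner_comm i l ▸ reachable_of_route h

theorem exists_linked_of_reachable {x : Fin 3} {w : W}
    (h : (C.glue S).Reachable (C.outerCorner x) w) (i : Fin 3) (v : V) (hv : C.copy i v = w) :
    ∃ l, Linked (fun i => cornerSetoid C.corner (S i)) x i l ∧ (S i).Reachable (C.corner l) v := by
  rw [SimpleGraph.reachable_iff_reflTransGen] at h
  induction h generalizing i v with
  | refl =>
    rcases eq_or_ne i x with rfl | hix
    · obtain rfl := (C.copy i).injective hv
      exact ⟨i, Linked.refl i, .rfl⟩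
    · exact absurd (C.corner.injective ((copy_eq_copy_iff hix).1 hv).2) hix.symm
  | tail _ hadj ih =>
    obtain ⟨j, v', w', hadj, hv', hw'⟩ := glue_adj.1 hadj
    obtain ⟨l, hl, hreach⟩ := ih j v' hv'
    have hreach := hreach.trans hadj.reachable
    rcases eq_or_ne i j with rfl | hij
    · obtain rfl := (C.copy i).injective (hv.trans hw'.symm)
      exact ⟨l, hl, hreach⟩
    · obtain ⟨rfl, rfl⟩ := (copy_eq_copy_iff hij).1 (hv.trans hw'.symm)
      exact ⟨j, (hl.trans hreach).symm, .rfl⟩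

theorem reachable_glue_iff_linked {x i l : Fin 3} :
    (C.glue S).Reachable (C.outerCorner x) (C.copy i (C.corner l)) ↔
      Linked (fun i => cornerSetoid C.corner (S i)) x i l := by
  refine ⟨fun h => ?_, reachable_of_linked⟩
  obtain ⟨m, hm, hreach⟩ := exists_linked_of_reachable h i _ rfl
  exact hm.trans hreach

theorem cornerSetoid_glue_iff {x y : Fin 3} :
    cornerSetoid C.outerCorner (C.glue S) x y ↔
      Route (fun i => cornerSetoid C.corner (S i)) x y y :=
  reachable_glue_iff_linked.trans or_self_iff

theorem cornerRooted_glue_iff : CornerRooted C.outerCorner (C.glue S) ↔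
    (∀ i, CornerRooted C.corner (S i)) ∧
      ∀ i l, ∃ x, Linked (fun i => cornerSetoid C.corner (S i)) x i l := by
  constructor
  · refine fun h => ⟨fun i v => ?_, fun i l => (h _).imp fun x => reachable_glue_iff_linked.1⟩
    obtain ⟨x, hx⟩ := h (C.copy i v)
    exact (exists_linked_of_reachable hx i v rfl).imp fun l => And.right
  · rintro ⟨hS, hlinked⟩ w
    obtain ⟨i, v, rfl⟩ := C.exists_copy_eq w
    obtain ⟨l, hl⟩ := hS i v
    obtain ⟨x, hx⟩ := hlinked i l
    exact ⟨x, (reachable_of_linked hx).trans (reachable_copy hl)⟩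

end CornerGluing

instance (R : Fin 3 → Setoid (Fin 3)) [∀ i, DecidableRel (R i)] (x i l : Fin 3) :
    Decidable (Route R x i l) :=
  inferInstanceAs (Decidable (∃ _, _))

instance (R : Fin 3 → Setoid (Fin 3)) [∀ i, DecidableRel (R i)] (x i l : Fin 3) :
    Decidable (Linked R x i l) :=
  inferInstanceAs (Decidable (_ ∨ _))

/-- The partitions of the three corners: `isolated i` separates the corner `i` from the other
two. -/
inductive CornerPattern
  | joined
  | isolated (i : Fin 3)
  | separated
  deriving DecidableEq, Fintype

namespace CornerPattern

theorem sum_univ {M : Type*} [AddCommMonoid M] (f : CornerPattern → M) :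
    ∑ τ, f τ = f joined + ∑ i, f (isolated i) + f separated := by
  have h : (Finset.univ : Finset CornerPattern) =
      {joined, isolated 0, isolated 1, isolated 2, separated} := by decide
  simp [h, Fin.sum_univ_three, add_assoc]

/-- The partition as an equivalence relation. -/
@[reducible] def setoid : CornerPattern → Setoid (Fin 3)
  | joined => ⊤
  | isolated i => Setoid.ker fun x => decide (x = i)
  | separated => ⊥

instance (τ : CornerPattern) : DecidableRel τ.setoid := fun x y =>
  match τ with
  | joined => isTrue trivial
  | isolated i => inferInstanceAs (Decidable (decide (x = i) = decide (y = i)))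
  | separated => inferInstanceAs (Decidable (x = y))

/-- The number of blocks of the partition. -/
def numBlocks : CornerPattern → ℕ
  | joined => 1
  | isolated _ => 2
  | separated => 3

theorem card_quotient_setoid (τ : CornerPattern) : Nat.card (Quotient τ.setoid) = τ.numBlocks := by
  rw [Nat.card_eq_fintype_card]
  revert τ
  decide

theorem setoid_injective : Function.Injective setoid := by
  have h : ∀ τ σ : CornerPattern, (∀ x y, τ.setoid x y ↔ σ.setoid x y) → τ = σ := by decide
  exact fun τ σ hτσ => h τ σ fun x y => by rw [hτσ]

theorem setoid_surjective : Function.Surjective setoid := by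
  classical
  have h : ∀ b : Fin 3 → Fin 3 → Bool, (∀ x, b x x) → (∀ x y, b x y → b y x) →
      (∀ x y z, b x y → b y z → b x z) → ∃ τ : CornerPattern, ∀ x y, τ.setoid x y ↔ b x y := by
    decide +kernel
  intro r
  obtain ⟨τ, hτ⟩ := h (fun x y => decide (r x y)) (by simp)
    (by simpa using fun x y => r.symm) (by simpa using fun x y z => r.trans)
  exact ⟨τ, Setoid.ext fun x y => (hτ x y).trans decide_eq_true_iff⟩

/-- The pattern `τ` of the outer corners results from gluing three forests whose corners have the
patterns `t i`, so that the result is acyclic (by the count of components) and each of its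
components contains an outer corner. -/
def IsGluing (t : Fin 3 → CornerPattern) (τ : CornerPattern) : Prop :=
  ∑ i, (t i).numBlocks = τ.numBlocks + 3 ∧
    (∀ i l, ∃ x, Linked (fun i => (t i).setoid) x i l) ∧
      ∀ x y, τ.setoid x y ↔ Route (fun i => (t i).setoid) x y y

instance (t : Fin 3 → CornerPattern) (τ : CornerPattern) : Decidable (IsGluing t τ) :=
  inferInstanceAs (Decidable (_ ∧ _))

/-- The triples of patterns that glue to the pattern `τ`. -/
def gluings (τ : CornerPattern) : Finset (Fin 3 → CornerPattern) := {t | IsGluing t τ}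

theorem mem_gluings {t : Fin 3 → CornerPattern} {τ : CornerPattern} :
    t ∈ gluings τ ↔ IsGluing t τ := Finset.mem_filter_univ t

/-- Up to a factor depending only on the number of blocks, the number of forests inducing the
pattern. -/
def weight : CornerPattern → ℕ
  | separated => 3
  | _ => 1

theorem weight_pos (τ : CornerPattern) : 0 < τ.weight := by
  cases τ <;> simp [weight]

/-- The total weight of the triples of patterns that glue to the pattern `τ`. -/
def totalWeight (τ : CornerPattern) : ℕ := ∑ t ∈ gluings τ, ∏ i, (t i).weight

theorem totalWeight_eq (τ : CornerPattern) :
    (totalWeight τ : ℝ) = 18 / 5 * (5 / 3) ^ τ.numBlocks * τ.weight := by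
  have h : totalWeight joined = 6 ∧ (∀ i, totalWeight (isolated i) = 10) ∧
      totalWeight separated = 50 := by decide +kernel
  cases τ <;> norm_num [h, numBlocks, weight]

theorem totalWeight_pos (τ : CornerPattern) : 0 < totalWeight τ := by
  have h := totalWeight_eq τ
  have hw := τ.weight_pos
  rify
  rw [h]
  positivity

/-- The total weight of the triples gluing to `τ` in which the forest on copy `i` has the
pattern `σ`. -/
def transferWeight (i : Fin 3) (τ σ : CornerPattern) : ℕ :=
  ∑ t ∈ gluings τ with t i = σ, ∏ j, (t j).weight

/-- The law of the pattern on copy `i` given the pattern `τ` of the glued forest. -/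
noncomputable def transfer (i : Fin 3) : Matrix CornerPattern CornerPattern ℝ :=
  Matrix.of fun τ σ => (transferWeight i τ σ : ℝ) / totalWeight τ

theorem transfer_mem_rowStochastic (i : Fin 3) :
    transfer i ∈ Matrix.rowStochastic ℝ CornerPattern := by
  refine Matrix.mem_rowStochastic_iff_sum.2
    ⟨fun τ σ => div_nonneg (Nat.cast_nonneg _) (Nat.cast_nonneg _), fun τ => ?_⟩
  have hpos := totalWeight_pos τ
  simp only [transfer, Matrix.of_apply, ← Finset.sum_div]
  rw [div_eq_one_iff_eq (by positivity)]
  exact_mod_cast Finset.sum_fiberwise (gluings τ) (fun t => t i) fun t => ∏ j, (t j).weight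

theorem transfer_joined_pos (i : Fin 3) (τ : CornerPattern) : 0 < transfer i τ joined := by
  have h : ∀ i τ, 0 < transferWeight i τ joined := by decide +kernel
  exact div_pos (Nat.cast_pos.2 (h i τ)) (Nat.cast_pos.2 (totalWeight_pos τ))

/-- The stationary law `stationary i`, multiplied by `28`. -/
def stationaryWeight (i : Fin 3) : CornerPattern → ℕ
  | joined => 18
  | isolated j => if j = i then 0 else 5
  | separated => 0

/-- The stationary law of the pattern on copy `i`: the limit law under repeated subdivision. -/
noncomputable def stationary (i : Fin 3) (τ : CornerPattern) : ℝ := stationaryWeight i τ / 28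

theorem sum_stationary (i : Fin 3) : ∑ τ, stationary i τ = 1 := by
  have h : ∀ i, ∑ τ, stationaryWeight i τ = 28 := by decide +kernel
  simp only [stationary, ← Finset.sum_div, ← Nat.cast_sum, h]
  norm_num

theorem stationary_vecMul_transfer (i : Fin 3) :
    stationary i ᵥ* transfer i = stationary i := by
  have hweights : ∀ i σ, ∑ τ, stationaryWeight i τ * (150 / totalWeight τ) * transferWeight i τ σ =
      150 * stationaryWeight i σ := by decide +kernel
  have hdiv : ∀ τ, totalWeight τ ∣ 150 := by decide +kernel
  ext σ
  have hσ : ∑ τ, (stationaryWeight i τ : ℝ) * (150 / totalWeight τ) * transferWeight i τ σ =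
      150 * stationaryWeight i σ := by
    rw [← Nat.cast_ofNat (n := 150)]
    simp only [← Nat.cast_div (hdiv _) (Nat.cast_ne_zero.2 (totalWeight_pos _).ne')]
    exact_mod_cast hweights i σ
  have hterm (τ : CornerPattern) : stationary i τ * transfer i τ σ =
      stationaryWeight i τ * (150 / totalWeight τ) * transferWeight i τ σ / (28 * 150) := by
    simp only [stationary, transfer, Matrix.of_apply]
    ring
  calc (stationary i ᵥ* transfer i) σ
      = ∑ τ, (stationaryWeight i τ : ℝ) * (150 / totalWeight τ) * transferWeight i τ σ /
          (28 * 150) := Fintype.sum_congr _ _ hterm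
    _ = stationary i σ := by
      rw [← Finset.sum_div, hσ, stationary]
      ring

end CornerPattern

section PatternForest

variable {V W : Type*} {c : Fin 3 → V} {τ : CornerPattern} {H T : SimpleGraph V}

/-- `T` is a forest, each of its components contains a corner, and its components induce the
partition `τ` of the corners. For `τ = joined` these are the trees. -/
structure IsPatternForest (c : Fin 3 → V) (τ : CornerPattern) (T : SimpleGraph V) : Prop where
  isAcyclic : T.IsAcyclic
  cornerRooted : CornerRooted c T
  cornerSetoid_eq : cornerSetoid c T = τ.setoid

theorem isPatternForest_iff [Finite V] : IsPatternForest c τ T ↔ CornerRooted c T ∧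
    cornerSetoid c T = τ.setoid ∧ T.edgeSet.ncard + τ.numBlocks = Nat.card V := by
  refine ⟨fun h => ⟨h.2, h.3, ?_⟩, fun ⟨hroot, hτ, hcard⟩ => ⟨?_, hroot, hτ⟩⟩
  · rw [← ncard_edgeSet_add_card_connectedComponent h.1, h.2.card_connectedComponent, h.3,
      τ.card_quotient_setoid]
  · rw [isAcyclic_iff_ncard_edgeSet_add_card_connectedComponent, ← hcard,
      hroot.card_connectedComponent, hτ, τ.card_quotient_setoid]

theorem isPatternForest_joined_iff : IsPatternForest c .joined T ↔ T.IsTree := by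
  constructor
  · rintro ⟨hacyclic, hroot, hτ⟩
    have hjoined (i j : Fin 3) : T.Reachable (c i) (c j) := by
      rw [← cornerSetoid_iff, hτ]
      trivial
    have : Nonempty V := ⟨c 0⟩
    refine ⟨⟨fun v w => ?_⟩, hacyclic⟩
    obtain ⟨i, hi⟩ := hroot v
    obtain ⟨j, hj⟩ := hroot w
    exact hi.symm.trans ((hjoined i j).trans hj)
  · exact fun h => ⟨h.isAcyclic, fun v => ⟨0, h.connected _ v⟩,
      Setoid.ext fun i j => iff_of_true (h.connected _ _) trivial⟩

theorem IsPatternForest.pattern_eq {σ : CornerPattern} (hτ : IsPatternForest c τ T)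
    (hσ : IsPatternForest c σ T) : τ = σ :=
  CornerPattern.setoid_injective (hτ.cornerSetoid_eq.symm.trans hσ.cornerSetoid_eq)

variable {C : CornerGluing (Fin 3) V W} {S : Fin 3 → SimpleGraph V} {t : Fin 3 → CornerPattern}

theorem isPatternForest_glue_iff_mem_gluings [Finite V] [Finite W]
    (hS : ∀ i, IsPatternForest C.corner (t i) (S i)) :
    IsPatternForest C.outerCorner τ (C.glue S) ↔ t ∈ CornerPattern.gluings τ := by
  have hcount (i : Fin 3) : (S i).edgeSet.ncard + (t i).numBlocks = Nat.card V :=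
    (isPatternForest_iff.1 (hS i)).2.2
  have hedges := C.ncard_edgeSet_glue (S := S)
  have hvertices := C.card_add_three_eq
  simp only [Fin.sum_univ_three] at hedges
  have hblocks : (C.glue S).edgeSet.ncard + τ.numBlocks = Nat.card W ↔
      ∑ i, (t i).numBlocks = τ.numBlocks + 3 := by
    simp only [Fin.sum_univ_three]
    have h₀ := hcount 0
    have h₁ := hcount 1
    have h₂ := hcount 2
    omega
  have hpatterns : (fun i => cornerSetoid C.corner (S i)) = fun i => (t i).setoid :=
    funext fun i => (hS i).cornerSetoid_eq
  have hsetoid : cornerSetoid C.outerCorner (C.glue S) = τ.setoid ↔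
      ∀ x y, τ.setoid x y ↔ Route (fun i => (t i).setoid) x y y := by
    simp only [← hpatterns, ← C.cornerSetoid_glue_iff]
    exact eq_comm.trans Setoid.ext_iff
  rw [CornerPattern.mem_gluings, CornerPattern.IsGluing, isPatternForest_iff,
    C.cornerRooted_glue_iff, hpatterns, hsetoid, hblocks,
    and_iff_right fun i => (hS i).cornerRooted]
  tauto

theorem IsPatternForest.exists_pattern_of_glue
    (h : IsPatternForest C.outerCorner τ (C.glue S)) (i : Fin 3) :
    ∃ σ, IsPatternForest C.corner σ (S i) := by
  obtain ⟨σ, hσ⟩ := CornerPattern.setoid_surjective (cornerSetoid C.corner (S i))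
  have hacyclic := h.isAcyclic.of_comap (C.copy i)
  change (C.piece (C.glue S) i).IsAcyclic at hacyclic
  rw [C.piece_glue] at hacyclic
  exact ⟨σ, hacyclic, (C.cornerRooted_glue_iff.1 h.cornerRooted).1 i, hσ.symm⟩

theorem isPatternForest_glue_iff [Finite V] [Finite W] :
    IsPatternForest C.outerCorner τ (C.glue S) ↔
      ∃ t ∈ CornerPattern.gluings τ, ∀ i, IsPatternForest C.corner (t i) (S i) := by
  constructor
  · intro h
    choose t ht using h.exists_pattern_of_glue
    exact ⟨t, (isPatternForest_glue_iff_mem_gluings ht).1 h, ht⟩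
  · rintro ⟨t, ht, hS⟩
    exact (isPatternForest_glue_iff_mem_gluings hS).2 ht

/-- The subgraphs of `H` that are forests inducing the pattern `τ`. -/
noncomputable def patternForests [Finite V] (c : Fin 3 → V) (H : SimpleGraph V)
    (τ : CornerPattern) : Finset (SimpleGraph V) :=
  (Set.toFinite {T | T ≤ H ∧ IsPatternForest c τ T}).toFinset

theorem mem_patternForests [Finite V] :
    T ∈ patternForests c H τ ↔ T ≤ H ∧ IsPatternForest c τ T :=
  Set.Finite.mem_toFinset _

theorem sum_patternForests_glue [Finite V] [Finite W] {M : Type*} [AddCommMonoid M]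
    (C : CornerGluing (Fin 3) V W) (H : SimpleGraph V) (τ : CornerPattern)
    (φ : (Fin 3 → SimpleGraph V) → M) :
    ∑ T ∈ patternForests C.outerCorner (C.glue fun _ => H) τ, φ (C.piece T) =
      ∑ t ∈ CornerPattern.gluings τ,
        ∑ S ∈ Fintype.piFinset fun i => patternForests C.corner H (t i), φ S := by
  rw [Finset.sum_sigma']
  symm
  refine Finset.sum_bij (fun p _ => C.glue p.2) ?_ ?_ ?_ ?_
  · rintro ⟨t, S⟩ hS
    simp only [Finset.mem_sigma, Fintype.mem_piFinset, mem_patternForests] at hS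
    exact mem_patternForests.2 ⟨C.glue_le_glue_iff.2 fun i => (hS.2 i).1,
      isPatternForest_glue_iff.2 ⟨t, hS.1, fun i => (hS.2 i).2⟩⟩
  · rintro ⟨t, S⟩ hS ⟨t', S'⟩ hS' heq
    obtain rfl : S = S' := C.glue_injective heq
    simp only [Finset.mem_sigma, Fintype.mem_piFinset, mem_patternForests] at hS hS'
    rw [funext fun i => (hS.2 i).2.pattern_eq (hS'.2 i).2]
  · intro T hT
    obtain ⟨hle, hT⟩ := mem_patternForests.1 hT
    have hglue := C.glue_piece hle
    rw [← hglue] at hle hT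
    obtain ⟨t, ht, hS⟩ := isPatternForest_glue_iff.1 hT
    refine ⟨⟨t, C.piece T⟩, ?_, hglue⟩
    simp only [Finset.mem_sigma, Fintype.mem_piFinset, mem_patternForests]
    exact ⟨ht, fun i => ⟨C.glue_le_glue_iff.1 hle i, hS i⟩⟩
  · exact fun p _ => by rw [C.piece_glue]

theorem sum_patternForests_glue_prod [Finite V] [Finite W] {R : Type*} [CommSemiring R]
    (C : CornerGluing (Fin 3) V W) (H : SimpleGraph V) (τ : CornerPattern)
    (φ : Fin 3 → SimpleGraph V → R) :
    ∑ T ∈ patternForests C.outerCorner (C.glue fun _ => H) τ, ∏ i, φ i (C.piece T i) =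
      ∑ t ∈ CornerPattern.gluings τ, ∏ i, ∑ S ∈ patternForests C.corner H (t i), φ i S := by
  refine (sum_patternForests_glue C H τ fun S => ∏ i, φ i (S i)).trans
    (Finset.sum_congr rfl fun t _ => ?_)
  exact (Finset.prod_univ_sum (fun i => patternForests C.corner H (t i)) φ).symm

/-- The numbers of forests are in the proportions of the weights, up to a geometric dependence on
the number of blocks. -/
def HasWeightedCounts [Finite V] (c : Fin 3 → V) (H : SimpleGraph V) : Prop :=
  ∃ a r : ℝ, 0 < a ∧ 0 < r ∧
    ∀ τ, ((patternForests c H τ).card : ℝ) = a * r ^ τ.numBlocks * τ.weight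

theorem prod_card_patternForests [Finite V] {a r : ℝ}
    (hcard : ∀ τ, ((patternForests c H τ).card : ℝ) = a * r ^ τ.numBlocks * τ.weight)
    (ht : t ∈ CornerPattern.gluings τ) :
    ∏ i, ((patternForests c H (t i)).card : ℝ) =
      (a * r) ^ 3 * r ^ τ.numBlocks * ∏ i, ((t i).weight : ℝ) := by
  have hblocks : ∑ i, (t i).numBlocks = τ.numBlocks + 3 := (CornerPattern.mem_gluings.1 ht).1
  simp only [hcard, Finset.prod_mul_distrib, Finset.prod_const, Finset.prod_pow_eq_pow_sum,
    hblocks, Finset.card_univ, Fintype.card_fin]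
  ring

theorem card_patternForests_glue [Finite V] [Finite W] {a r : ℝ}
    (hcard : ∀ τ, ((patternForests C.corner H τ).card : ℝ) = a * r ^ τ.numBlocks * τ.weight) :
    ((patternForests C.outerCorner (C.glue fun _ => H) τ).card : ℝ) =
      (a * r) ^ 3 * r ^ τ.numBlocks * τ.totalWeight := by
  have h := sum_patternForests_glue_prod C H τ fun _ _ => (1 : ℝ)
  simp only [Finset.prod_const_one, Finset.sum_const, nsmul_eq_mul, mul_one] at h
  rw [h, Finset.sum_congr rfl fun t ht => prod_card_patternForests hcard ht, ← Finset.mul_sum]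
  simp only [CornerPattern.totalWeight, Nat.cast_sum, Nat.cast_prod]

theorem HasWeightedCounts.glue [Finite V] [Finite W] (h : HasWeightedCounts C.corner H) :
    HasWeightedCounts C.outerCorner (C.glue fun _ => H) := by
  obtain ⟨a, r, ha, hr, hcard⟩ := h
  refine ⟨18 / 5 * (a * r) ^ 3, 5 / 3 * r, by positivity, by positivity, fun τ => ?_⟩
  rw [card_patternForests_glue hcard, τ.totalWeight_eq]
  ring

theorem HasWeightedCounts.patternForests_nonempty [Finite V] (h : HasWeightedCounts c H)
    (τ : CornerPattern) : (patternForests c H τ).Nonempty := by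
  obtain ⟨a, r, ha, hr, hcard⟩ := h
  have hw := τ.weight_pos
  have hpos : (0 : ℝ) < (patternForests c H τ).card := by
    rw [hcard]
    positivity
  exact Finset.card_pos.1 (Nat.cast_pos.1 hpos)

theorem expect_patternForests_glue_prod [Finite V] [Finite W] (h : HasWeightedCounts C.corner H)
    (φ : Fin 3 → SimpleGraph V → ℝ) :
    𝔼 T ∈ patternForests C.outerCorner (C.glue fun _ => H) τ, ∏ i, φ i (C.piece T i) =
      ∑ t ∈ CornerPattern.gluings τ, (∏ i, ((t i).weight : ℝ)) / τ.totalWeight *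
        ∏ i, 𝔼 S ∈ patternForests C.corner H (t i), φ i S := by
  obtain ⟨a, r, ha, hr, hcard⟩ := h
  have htotal := τ.totalWeight_pos
  rw [Finset.expect_eq_sum_div_card, sum_patternForests_glue_prod,
    card_patternForests_glue hcard, Finset.sum_div]
  refine Finset.sum_congr rfl fun t ht => ?_
  have hsum (i : Fin 3) : ∑ S ∈ patternForests C.corner H (t i), φ i S =
      (patternForests C.corner H (t i)).card * 𝔼 S ∈ patternForests C.corner H (t i), φ i S :=
    (Finset.card_mul_expect _ _).symm
  simp only [hsum, Finset.prod_mul_distrib]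
  rw [prod_card_patternForests hcard ht]
  field_simp

end PatternForest

open CornerPattern

section DegreeLaw

variable {V W : Type*} [Finite V] [Finite W]

/-- The proportion of the subforests of `H` with pattern `τ` in which `v` has degree `d`. -/
noncomputable def degreeLaw (c : Fin 3 → V) (H : SimpleGraph V) (τ : CornerPattern) (v : V)
    (d : ℕ) : ℝ :=
  𝔼 T ∈ patternForests c H τ, if (T.neighborSet v).ncard = d then 1 else 0

variable {C : CornerGluing (Fin 3) V W} {H : SimpleGraph V}

theorem expect_patternForests_glue_piece (h : HasWeightedCounts C.corner H) (τ : CornerPattern)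
    (i : Fin 3) (φ : SimpleGraph V → ℝ) :
    𝔼 T ∈ patternForests C.outerCorner (C.glue fun _ => H) τ, φ (C.piece T i) =
      (transfer i *ᵥ fun σ => 𝔼 S ∈ patternForests C.corner H σ, φ S) τ := by
  have hmean (t : Fin 3 → CornerPattern) (j : Fin 3) :
      (𝔼 S ∈ patternForests C.corner H (t j), if j = i then φ S else 1) =
        if j = i then 𝔼 S ∈ patternForests C.corner H (t j), φ S else 1 := by
    split_ifs
    · rfl
    · exact Finset.expect_const (h.patternForests_nonempty _) _
  have hprod := expect_patternForests_glue_prod (τ := τ) h fun j S => if j = i then φ S else 1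
  simp only [hmean, Finset.prod_ite_eq', Finset.mem_univ, if_true] at hprod
  rw [hprod, ← Finset.sum_fiberwise (gluings τ) fun t => t i, Matrix.mulVec,
    dotProduct]
  refine Finset.sum_congr rfl fun σ _ => ?_
  rw [transfer, Matrix.of_apply, transferWeight, Nat.cast_sum, Finset.sum_div, Finset.sum_mul]
  refine Finset.sum_congr rfl fun t ht => ?_
  rw [(Finset.mem_filter.1 ht).2, Nat.cast_prod]

theorem expect_patternForests_glue_mul (h : HasWeightedCounts C.corner H) (τ : CornerPattern)
    {i j : Fin 3} (hij : i ≠ j) (φ ψ : SimpleGraph V → ℝ) :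
    𝔼 T ∈ patternForests C.outerCorner (C.glue fun _ => H) τ,
        φ (C.piece T i) * ψ (C.piece T j) =
      ∑ t ∈ gluings τ, (∏ k, ((t k).weight : ℝ)) / τ.totalWeight *
        ((𝔼 S ∈ patternForests C.corner H (t i), φ S) *
          𝔼 S ∈ patternForests C.corner H (t j), ψ S) := by
  have hmean (t : Fin 3 → CornerPattern) (k : Fin 3) (hk : k ≠ i ∧ k ≠ j) :
      (𝔼 S ∈ patternForests C.corner H (t k),
        if k = i then φ S else if k = j then ψ S else 1) = 1 := by
    simp only [if_neg hk.1, if_neg hk.2]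
    exact Finset.expect_const (h.patternForests_nonempty _) _
  have hprod := expect_patternForests_glue_prod (τ := τ) h fun k S =>
    if k = i then φ S else if k = j then ψ S else 1
  simp only [Fintype.prod_eq_mul i j hij (hmean _), Fintype.prod_eq_mul i j hij
    fun _ hk => (if_neg hk.1).trans (if_neg hk.2), if_true, if_neg hij.symm] at hprod
  exact hprod

theorem degreeLaw_glue_copy (h : HasWeightedCounts C.corner H) (τ : CornerPattern) {i : Fin 3}
    {v : V} (hv : ∀ j ≠ i, v ≠ C.corner j) (d : ℕ) :
    degreeLaw C.outerCorner (C.glue fun _ => H) τ (C.copy i v) d =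
      (transfer i *ᵥ fun σ => degreeLaw C.corner H σ v d) τ := by
  refine (Finset.expect_congr rfl fun T hT => ?_).trans (expect_patternForests_glue_piece h τ i
    fun S => if (S.neighborSet v).ncard = d then 1 else 0)
  rw [← C.ncard_neighborSet_glue_of_forall_ne hv, C.glue_piece (mem_patternForests.1 hT).1]

theorem degreeLaw_glue_copy_corner (h : HasWeightedCounts C.corner H) (τ : CornerPattern)
    {i j : Fin 3} (hij : i ≠ j) (d : ℕ) :
    degreeLaw C.outerCorner (C.glue fun _ => H) τ (C.copy i (C.corner j)) d =
      ∑ p ∈ Finset.HasAntidiagonal.antidiagonal d, ∑ t ∈ gluings τ,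
        (∏ k, ((t k).weight : ℝ)) / τ.totalWeight *
          (degreeLaw C.corner H (t i) (C.corner j) p.1 *
            degreeLaw C.corner H (t j) (C.corner i) p.2) := by
  have hadd (a b : ℕ) : (if a + b = d then (1 : ℝ) else 0) =
      ∑ p ∈ Finset.HasAntidiagonal.antidiagonal d, (if a = p.1 then 1 else 0) *
        if b = p.2 then 1 else 0 := by
    have hpair (p : ℕ × ℕ) : ((if a = p.1 then (1 : ℝ) else 0) * if b = p.2 then 1 else 0) =
        if (a, b) = p then 1 else 0 := by
      rw [ite_zero_mul_ite_zero, one_mul]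
      exact if_congr (Prod.ext_iff (x := (a, b))).symm rfl rfl
    simp only [hpair, Finset.sum_ite_eq, Finset.HasAntidiagonal.mem_antidiagonal]
  simp only [degreeLaw, ← expect_patternForests_glue_mul h τ hij, ← Finset.expect_sum_comm]
  refine Finset.expect_congr rfl fun T hT => ?_
  rw [← hadd, ← C.ncard_neighborSet_glue_corner hij, C.glue_piece (mem_patternForests.1 hT).1]

theorem sum_gluings_prod_weight_div (τ : CornerPattern) :
    ∑ t ∈ gluings τ, (∏ k, ((t k).weight : ℝ)) / τ.totalWeight = 1 := by
  rw [← Finset.sum_div, div_eq_one_iff_eq (Nat.cast_ne_zero.2 τ.totalWeight_pos.ne'), totalWeight]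
  push_cast
  rfl

end DegreeLaw

section Triangle

/-- The graph on three vertices whose edges are those opposite to the vertices in `A`. -/
def triangle (A : Finset (Fin 3)) : SimpleGraph (Fin 3) where
  Adj i j := i ≠ j ∧ -(i + j) ∈ A
  symm := ⟨fun i j h => ⟨h.1.symm, by rw [add_comm]; exact h.2⟩⟩
  loopless := ⟨fun _ h => h.1 rfl⟩

instance (A : Finset (Fin 3)) : DecidableRel (triangle A).Adj := fun i j =>
  inferInstanceAs (Decidable (i ≠ j ∧ -(i + j) ∈ A))

/-- The sets `A` for which `triangle A` is a forest inducing the pattern `τ`. -/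
def triangleForests (τ : CornerPattern) : Finset (Finset (Fin 3)) :=
  {A | (∀ i j, τ.setoid i j ↔ (triangle A).Reachable i j) ∧ A.card + τ.numBlocks = 3}

theorem mem_triangleForests {A : Finset (Fin 3)} {τ : CornerPattern} : A ∈ triangleForests τ ↔
    (∀ i j, τ.setoid i j ↔ (triangle A).Reachable i j) ∧ A.card + τ.numBlocks = 3 :=
  Finset.mem_filter_univ A

theorem ncard_edgeSet_triangle (A : Finset (Fin 3)) : (triangle A).edgeSet.ncard = A.card := by
  have h : ∀ A : Finset (Fin 3), (triangle A).edgeFinset.card = A.card := by decide +kernel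
  rw [← h, ← SimpleGraph.coe_edgeFinset, Set.ncard_coe_finset]

theorem triangle_injective : Function.Injective triangle := by
  have h : ∀ A B : Finset (Fin 3),
      (∀ i j, (triangle A).Adj i j ↔ (triangle B).Adj i j) → A = B := by
    decide +kernel
  exact fun A B hAB => h A B fun i j => by rw [hAB]

theorem triangle_surjective : Function.Surjective triangle := by
  classical
  have hopposite : ∀ i j : Fin 3, i ≠ j →
      -(i + j) + 1 = i ∧ -(i + j) - 1 = j ∨ -(i + j) + 1 = j ∧ -(i + j) - 1 = i := by decide
  refine fun G => ⟨({k | G.Adj (k + 1) (k - 1)} : Finset (Fin 3)), ?_⟩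
  ext i j
  change (i ≠ j ∧ -(i + j) ∈ _) ↔ _
  rw [Finset.mem_filter_univ]
  rcases eq_or_ne i j with rfl | hij
  · simp only [ne_eq, not_true_eq_false, false_and, SimpleGraph.irrefl]
  · rcases hopposite i j hij with ⟨h, h'⟩ | ⟨h, h'⟩
    · rw [h, h', and_iff_right hij]
    · rw [h, h', and_iff_right hij, SimpleGraph.adj_comm]

theorem map_degree_triangleForests_joined (i : Fin 3) :
    ((triangleForests joined).val.map fun A => (triangle A).degree i) = {1, 1, 2} := by
  revert i
  decide +kernel

theorem map_degree_triangleForests_isolated {i j : Fin 3} (hji : j ≠ i) :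
    ((triangleForests (isolated j)).val.map fun A => (triangle A).degree i) = {1} := by
  revert i j
  decide +kernel

variable {V : Type*} (c : Fin 3 ≃ V)

/-- The graphs on a set of three vertices, in terms of the sets of missing vertices as in
`triangle`. -/
noncomputable def triangleEquiv : Finset (Fin 3) ≃ SimpleGraph V :=
  (Equiv.ofBijective triangle ⟨triangle_injective, triangle_surjective⟩).trans c.simpleGraph

theorem triangleEquiv_apply (A : Finset (Fin 3)) :
    triangleEquiv c A = (triangle A).map c.toEmbedding :=
  SimpleGraph.comap_symm _ _

variable [Finite V]

theorem isPatternForest_map_triangle_iff {A : Finset (Fin 3)} {τ : CornerPattern} :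
    IsPatternForest c τ ((triangle A).map c.toEmbedding) ↔ A ∈ triangleForests τ := by
  have hreach (i j : Fin 3) :
      ((triangle A).map c.toEmbedding).Reachable (c i) (c j) ↔ (triangle A).Reachable i j :=
    (SimpleGraph.Iso.map c (triangle A)).reachable_iff
  have hrooted : CornerRooted c ((triangle A).map c.toEmbedding) := fun v =>
    ⟨c.symm v, by rw [c.apply_symm_apply]⟩
  rw [isPatternForest_iff, and_iff_right hrooted, mem_triangleForests, ncard_edgeSet_map,
    ncard_edgeSet_triangle, ← Nat.card_congr c, Nat.card_eq_fintype_card, Fintype.card_fin]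
  refine and_congr_left' (eq_comm.trans (Setoid.ext_iff.trans ?_))
  simp only [cornerSetoid_iff, hreach]

theorem triangleEquiv_mem_patternForests_iff {A : Finset (Fin 3)} {τ : CornerPattern} :
    triangleEquiv c A ∈ patternForests c ⊤ τ ↔ A ∈ triangleForests τ := by
  rw [mem_patternForests, and_iff_right le_top, triangleEquiv_apply,
    isPatternForest_map_triangle_iff]

theorem hasWeightedCounts_top : HasWeightedCounts c ⊤ := by
  refine ⟨9, 1 / 3, by norm_num, by norm_num, fun τ => ?_⟩
  have hcard : (triangleForests τ).card = (patternForests c ⊤ τ).card :=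
    Finset.card_equiv (triangleEquiv c) fun A => (triangleEquiv_mem_patternForests_iff c).symm
  have h : (triangleForests joined).card = 3 ∧ (∀ i, (triangleForests (isolated i)).card = 1) ∧
      (triangleForests separated).card = 1 := by decide +kernel
  rw [← hcard]
  cases τ <;> norm_num [h, numBlocks, weight]

theorem degreeLaw_top (τ : CornerPattern) (i : Fin 3) (d : ℕ) :
    degreeLaw c ⊤ τ (c i) d =
      𝔼 A ∈ triangleForests τ, if (triangle A).degree i = d then 1 else 0 := by
  symm
  refine Finset.expect_equiv (triangleEquiv c)
    (fun A => (triangleEquiv_mem_patternForests_iff c).symm) fun A _ => ?_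
  have hdegree : ((triangleEquiv c A).neighborSet (c i)).ncard = (triangle A).degree i := by
    have hmap := (triangle A).neighborSet_map c.toEmbedding i
    rw [Equiv.coe_toEmbedding] at hmap
    rw [triangleEquiv_apply, Equiv.coe_toEmbedding, hmap,
      Set.ncard_image_of_injective _ c.injective, ← SimpleGraph.card_neighborSet_eq_degree,
      ← Nat.card_eq_fintype_card, Nat.card_coe_set_eq]
  rw [hdegree]

/-- The limit law of the degree of a corner. -/
noncomputable def cornerLaw (d : ℕ) : ℝ :=
  if d = 1 then 11 / 14 else if d = 2 then 3 / 14 else 0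

theorem stationary_dotProduct_degreeLaw_top (i : Fin 3) (d : ℕ) :
    stationary i ⬝ᵥ (fun τ => degreeLaw c ⊤ τ (c i) d) = cornerLaw d := by
  have hlaw {τ : CornerPattern} {M : Multiset ℕ}
      (hM : ((triangleForests τ).val.map fun A => (triangle A).degree i) = M) :
      degreeLaw c ⊤ τ (c i) d = (M.map fun e => if e = d then (1 : ℝ) else 0).sum / M.card := by
    rw [degreeLaw_top, Finset.expect_eq_sum_div_card, ← hM, Multiset.map_map, Multiset.card_map]
    rfl
  have hisolated (j : Fin 3) : stationary i (isolated j) * degreeLaw c ⊤ (isolated j) (c i) d =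
      if j ≠ i then 5 / 28 * (if 1 = d then 1 else 0) else 0 := by
    rcases eq_or_ne j i with rfl | hji
    · simp [stationary, stationaryWeight]
    · simp [stationary, stationaryWeight, hlaw (map_degree_triangleForests_isolated hji), hji]
  have hcard : (Finset.univ.filter fun j => j ≠ i).card = 2 := by
    rw [Finset.filter_ne', Finset.card_erase_of_mem (Finset.mem_univ i), Finset.card_univ,
      Fintype.card_fin]
  rw [dotProduct, CornerPattern.sum_univ, Finset.sum_congr rfl fun j _ => hisolated j,
    hlaw (map_degree_triangleForests_joined i), ← Finset.sum_filter, Finset.sum_const, hcard]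
  by_cases h₁ : d = 1
  · subst h₁
    norm_num [stationary, stationaryWeight, cornerLaw]
  by_cases h₂ : d = 2
  · subst h₂
    norm_num [stationary, stationaryWeight, cornerLaw]
  · simp [stationary, stationaryWeight, cornerLaw, h₁, h₂, Ne.symm h₁, Ne.symm h₂]

end Triangle

section Gasket

/-- The three outmost vertices of `SG(n)`; copy `i` of `SG(n)` in `SG(n + 1)` is the translate by
the corner `i`. -/
def cornerPoint (n : ℕ) : Fin 3 → ℕ × ℕ := ![(0, 0), (2 ^ n, 0), (0, 2 ^ n)]

theorem cornerPoint_mem_verts (n : ℕ) (i : Fin 3) : cornerPoint n i ∈ verts n := by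
  obtain ⟨h₀, h₁, h₂⟩ := corners_mem n
  fin_cases i
  exacts [h₀, h₁, h₂]

theorem cornerPoint_injective (n : ℕ) : Function.Injective (cornerPoint n) := by
  have hpos : 2 ^ n ≠ 0 := by positivity
  intro i j
  fin_cases i <;> fin_cases j <;> simp [cornerPoint, hpos.symm]

theorem cornerPoint_fst (n : ℕ) (i : Fin 3) :
    (cornerPoint n i).1 = if i = 1 then 2 ^ n else 0 := by
  fin_cases i <;> rfl

theorem cornerPoint_snd (n : ℕ) (i : Fin 3) :
    (cornerPoint n i).2 = if i = 2 then 2 ^ n else 0 := by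
  fin_cases i <;> rfl

theorem cornerPoint_zero (n : ℕ) : cornerPoint n 0 = 0 := rfl

theorem cornerPoint_succ (n : ℕ) (i : Fin 3) :
    cornerPoint (n + 1) i = cornerPoint n i + cornerPoint n i := by
  fin_cases i <;> simp [cornerPoint, pow_succ, mul_two]

theorem mem_verts_succ {n : ℕ} {p : ℕ × ℕ} :
    p ∈ verts (n + 1) ↔ ∃ i, ∃ q ∈ verts n, q + cornerPoint n i = p := by
  simp only [Fin.exists_fin_succ, cornerPoint_zero, add_zero, exists_eq_right]
  simp [verts, cornerPoint]

theorem bonds_succ_adj {n : ℕ} {a b : ℕ × ℕ} : (bonds (n + 1)).Adj a b ↔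
    ∃ i p q, (bonds n).Adj p q ∧ p + cornerPoint n i = a ∧ q + cornerPoint n i = b := by
  simp only [Fin.exists_fin_succ, cornerPoint_zero, add_zero, exists_eq_right_right,
    exists_eq_right]
  simp [bonds, SimpleGraph.map_adj, cornerPoint, or_assoc]

theorem mem_verts_of_bonds_adj {n : ℕ} {p q : ℕ × ℕ} (h : (bonds n).Adj p q) : p ∈ verts n := by
  induction n generalizing p q with
  | zero =>
    simp only [bonds, SimpleGraph.fromEdgeSet_adj, Set.mem_insert_iff, Set.mem_singleton_iff,
      Sym2.eq_iff] at h
    rcases h with ⟨(⟨rfl, -⟩ | ⟨rfl, -⟩) | (⟨rfl, -⟩ | ⟨rfl, -⟩) | (⟨rfl, -⟩ | ⟨rfl, -⟩), -⟩ <;>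
      decide
  | succ n ih =>
    obtain ⟨i, p, q, hadj, rfl, rfl⟩ := bonds_succ_adj.1 h
    exact mem_verts_succ.2 ⟨i, p, ih hadj, rfl⟩

theorem add_le_of_mem_verts {n : ℕ} {p : ℕ × ℕ} (hp : p ∈ verts n) : p.1 + p.2 ≤ 2 ^ n := by
  induction n generalizing p with
  | zero =>
    revert p
    decide
  | succ n ih =>
    obtain ⟨i, q, hq, rfl⟩ := mem_verts_succ.1 hp
    have hq := ih hq
    simp only [Prod.fst_add, Prod.snd_add, cornerPoint_fst, cornerPoint_snd]
    grind

theorem eq_cornerPoint_of_add_eq_add {n : ℕ} {p q : ℕ × ℕ} {i j : Fin 3} (hij : i ≠ j)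
    (hp : p ∈ verts n) (hq : q ∈ verts n) (h : p + cornerPoint n i = q + cornerPoint n j) :
    p = cornerPoint n j := by
  have hp := add_le_of_mem_verts hp
  have hq := add_le_of_mem_verts hq
  simp only [Prod.ext_iff, Prod.fst_add, Prod.snd_add, cornerPoint_fst, cornerPoint_snd] at h ⊢
  grind

/-- `SG(n + 1)` as three copies of `SG(n)`. -/
def gasketGluing (n : ℕ) : CornerGluing (Fin 3) (Vertex n) (Vertex (n + 1)) where
  corner := ⟨fun i => ⟨cornerPoint n i, cornerPoint_mem_verts n i⟩, fun _ _ h =>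
    cornerPoint_injective n (congrArg Subtype.val h)⟩
  copy i := ⟨fun p => ⟨p + cornerPoint n i, mem_verts_succ.2 ⟨i, p, p.2, rfl⟩⟩, fun _ _ h =>
    Subtype.ext (add_right_cancel (congrArg Subtype.val h))⟩
  copy_corner_comm i j := Subtype.ext (add_comm _ _)
  eq_corner_of_copy_eq {_ _ p q} hij h := Subtype.ext
    (eq_cornerPoint_of_add_eq_add hij p.2 q.2 (congrArg Subtype.val h))
  exists_copy_eq w := by
    obtain ⟨i, q, hq, h⟩ := mem_verts_succ.1 w.2
    exact ⟨i, ⟨q, hq⟩, Subtype.ext h⟩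

/-- The corners of `SG(n)`. -/
abbrev gasketCorner (n : ℕ) : Fin 3 → Vertex n := (gasketGluing n).corner

theorem outerCorner_gasketGluing (n : ℕ) : (gasketGluing n).outerCorner = gasketCorner (n + 1) :=
  funext fun i => Subtype.ext (cornerPoint_succ n i).symm

theorem glue_SG (n : ℕ) : ((gasketGluing n).glue fun _ => SG n) = SG (n + 1) := by
  ext a b
  rw [CornerGluing.glue_adj]
  change _ ↔ (bonds (n + 1)).Adj a b
  rw [bonds_succ_adj]
  constructor
  · rintro ⟨i, p, q, hadj, rfl, rfl⟩
    exact ⟨i, p, q, hadj, rfl, rfl⟩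
  · rintro ⟨i, p, q, hadj, hp, hq⟩
    exact ⟨i, ⟨p, mem_verts_of_bonds_adj hadj⟩, ⟨q, mem_verts_of_bonds_adj hadj.symm⟩, hadj,
      Subtype.ext hp, Subtype.ext hq⟩

theorem SG_zero : SG 0 = ⊤ := by
  have h : ∀ p q : Vertex 0, p ≠ q → s((p : ℕ × ℕ), (q : ℕ × ℕ)) ∈
      ({s((0, 0), (1, 0)), s((0, 0), (0, 1)), s((1, 0), (0, 1))} : Finset (Sym2 (ℕ × ℕ))) := by
    decide
  ext p q
  refine ⟨fun hadj => hadj.ne, fun hpq => (SimpleGraph.fromEdgeSet_adj _).2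
    ⟨by simpa using h p q hpq, Subtype.coe_ne_coe.2 hpq⟩⟩

theorem gasketCorner_zero_bijective : Function.Bijective (gasketCorner 0) := by
  refine ⟨(gasketGluing 0).corner.injective, ?_⟩
  have h : ∀ p : Vertex 0, ∃ i, cornerPoint 0 i = p := by decide
  exact fun p => (h p).imp fun i => Subtype.ext

theorem hasWeightedCounts_SG (n : ℕ) : HasWeightedCounts (gasketCorner n) (SG n) := by
  induction n with
  | zero => exact SG_zero ▸ hasWeightedCounts_top (Equiv.ofBijective _ gasketCorner_zero_bijective)
  | succ n ih => exact outerCorner_gasketGluing n ▸ glue_SG n ▸ ih.glue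

/-- The proportion of the subforests of `SG(n)` with pattern `τ` in which `v` has degree `d`. -/
noncomputable abbrev gasketDegreeLaw (n : ℕ) (τ : CornerPattern) (v : Vertex n) (d : ℕ) : ℝ :=
  degreeLaw (gasketCorner n) (SG n) τ v d

theorem gasketDegreeLaw_copy {n : ℕ} (τ : CornerPattern) {i : Fin 3} {v : Vertex n}
    (hv : ∀ j ≠ i, v ≠ gasketCorner n j) (d : ℕ) :
    gasketDegreeLaw (n + 1) τ ((gasketGluing n).copy i v) d =
      (transfer i *ᵥ fun σ => gasketDegreeLaw n σ v d) τ := by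
  rw [← degreeLaw_glue_copy (hasWeightedCounts_SG n) τ hv, outerCorner_gasketGluing, glue_SG]

theorem tendsto_gasketDegreeLaw_corner (τ : CornerPattern) (i : Fin 3) (d : ℕ) :
    Tendsto (fun n => gasketDegreeLaw n τ (gasketCorner n i) d) atTop (𝓝 (cornerLaw d)) := by
  have hzero : stationary i ⬝ᵥ (fun σ => gasketDegreeLaw 0 σ (gasketCorner 0 i) d) =
      cornerLaw d := by
    simp only [gasketDegreeLaw, SG_zero]
    exact stationary_dotProduct_degreeLaw_top
      (Equiv.ofBijective _ gasketCorner_zero_bijective) i d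
  rw [← hzero]
  refine tendsto_of_rowStochastic_of_column_pos (transfer_mem_rowStochastic i)
    (transfer_joined_pos i) (stationary_vecMul_transfer i) (sum_stationary i)
    (u := fun n σ => gasketDegreeLaw n σ (gasketCorner n i) d) (fun n => funext fun σ => ?_) τ
  rw [← outerCorner_gasketGluing]
  exact gasketDegreeLaw_copy σ (fun j hji => (gasketGluing n).corner.injective.ne hji.symm) d

/-- The limit law of the degree of a vertex at which two copies meet: the two degrees that it has
in the copies become independent. -/
noncomputable def meetingLaw (d : ℕ) : ℝ :=
  ∑ p ∈ Finset.HasAntidiagonal.antidiagonal d, cornerLaw p.1 * cornerLaw p.2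

/-- The vertex of `SG(n + m + 1)` at which the copies `i` and `j` of `SG(n)` in `SG(n + 1)`
meet. -/
def meetingVertex (n : ℕ) (i j : Fin 3) : (m : ℕ) → Vertex (n + m + 1)
  | 0 => (gasketGluing n).copy i (gasketCorner n j)
  | m + 1 => (gasketGluing (n + m + 1)).copy 0 (meetingVertex n i j m)

theorem tendsto_gasketDegreeLaw_copy_corner {i j : Fin 3} (hij : i ≠ j) (τ : CornerPattern)
    (d : ℕ) : Tendsto (fun n => gasketDegreeLaw (n + 1) τ
      ((gasketGluing n).copy i (gasketCorner n j)) d) atTop (𝓝 (meetingLaw d)) := by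
  have hlaw (n : ℕ) := degreeLaw_glue_copy_corner (hasWeightedCounts_SG n) τ hij d
  simp only [outerCorner_gasketGluing, glue_SG] at hlaw
  simp only [hlaw]
  refine tendsto_finsetSum _ fun p _ => ?_
  rw [← one_mul (cornerLaw p.1 * cornerLaw p.2), ← sum_gluings_prod_weight_div τ, Finset.sum_mul]
  exact tendsto_finsetSum _ fun t _ => ((tendsto_gasketDegreeLaw_corner (t i) j p.1).mul
    (tendsto_gasketDegreeLaw_corner (t j) i p.2)).const_mul _

theorem meetingVertex_val (n m : ℕ) (i j : Fin 3) :
    (meetingVertex n i j m : ℕ × ℕ) = cornerPoint n i + cornerPoint n j := by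
  induction m with
  | zero => exact add_comm _ _
  | succ m ih =>
    rw [← ih]
    exact add_zero _

theorem meetingVertex_ne_gasketCorner (n m : ℕ) {i j k : Fin 3} (hij : i ≠ j) (hk : k ≠ 0) :
    meetingVertex n i j m ≠ gasketCorner (n + m + 1) k := by
  intro h
  have hval : cornerPoint n i + cornerPoint n j = cornerPoint (n + m + 1) k := by
    rw [← meetingVertex_val n m, h]
    rfl
  have hpow : 2 ^ (n + 1) ≤ 2 ^ (n + m + 1) := Nat.pow_le_pow_right two_pos (by omega)
  have hpos : 0 < 2 ^ n := by positivity
  rw [pow_succ] at hpow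
  simp only [Prod.ext_iff, Prod.fst_add, Prod.snd_add, cornerPoint_fst, cornerPoint_snd] at hval
  grind

theorem tendsto_gasketDegreeLaw_meetingVertex (m : ℕ) {i j : Fin 3} (hij : i ≠ j)
    (τ : CornerPattern) (d : ℕ) :
    Tendsto (fun n => gasketDegreeLaw (n + m + 1) τ (meetingVertex n i j m) d) atTop
      (𝓝 (meetingLaw d)) := by
  induction m generalizing τ with
  | zero => exact tendsto_gasketDegreeLaw_copy_corner hij τ d
  | succ m ih =>
    have hcopy (n : ℕ) := gasketDegreeLaw_copy τ
      (fun k hk => meetingVertex_ne_gasketCorner n m hij hk) d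
    refine Tendsto.congr (fun n => (hcopy n).symm) ?_
    rw [← one_mul (meetingLaw d),
      ← Matrix.sum_row_of_mem_rowStochastic (transfer_mem_rowStochastic 0) τ, Finset.sum_mul]
    exact tendsto_finsetSum _ fun σ _ => (ih σ).const_mul _

theorem isSpanningTree_iff_mem_patternForests {n : ℕ} {T : SimpleGraph (Vertex n)} :
    IsSpanningTree (SG n) T ↔ T ∈ patternForests (gasketCorner n) (SG n) joined := by
  rw [mem_patternForests, isPatternForest_joined_iff, IsSpanningTree]

theorem degProb_eq_gasketDegreeLaw (d n : ℕ) (v : Vertex n) :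
    degProb d n v = gasketDegreeLaw n joined v d := by
  classical
  have hdegree (T : SimpleGraph (Vertex n)) : T.degree v = (T.neighborSet v).ncard := by
    rw [← SimpleGraph.card_neighborSet_eq_degree, ← Nat.card_eq_fintype_card, Nat.card_coe_set_eq]
  rw [degProb, numTrees, numTreesDeg, gasketDegreeLaw, degreeLaw, Finset.expect_eq_sum_div_card,
    Finset.sum_boole]
  simp only [isSpanningTree_iff_mem_patternForests, hdegree, ← Finset.coe_filter,
    Set.ncard_coe_finset]
  rw [Finset.setOfPred_mem, Set.ncard_coe_finset]

theorem vertexA_eq_meetingVertex (n m : ℕ) : vertexA n m = meetingVertex n 0 1 m :=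
  Subtype.ext (by simp [meetingVertex_val, vertexA, cornerPoint])

theorem vertexB_eq_meetingVertex (n m : ℕ) : vertexB n m = meetingVertex n 0 2 m :=
  Subtype.ext (by simp [meetingVertex_val, vertexB, cornerPoint])

theorem vertexC_eq_meetingVertex (n m : ℕ) : vertexC n m = meetingVertex n 1 2 m :=
  Subtype.ext (by simp [meetingVertex_val, vertexC, cornerPoint])

theorem tendsto_degProb_of_exists_eq_meetingVertex {m : ℕ} {x : (n : ℕ) → Vertex (n + m + 1)}
    (hx : ∀ n, ∃ i j, i ≠ j ∧ x n = meetingVertex n i j m) (d : ℕ) :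
    Tendsto (fun n => degProb d (n + m + 1) (x n)) atTop (𝓝 (meetingLaw d)) := by
  simp only [degProb_eq_gasketDegreeLaw]
  refine tendsto_of_forall_exists_eq (ι := {p : Fin 3 × Fin 3 // p.1 ≠ p.2})
    (fun p => tendsto_gasketDegreeLaw_meetingVertex m p.2 joined d) fun n => ?_
  obtain ⟨i, j, hij, h⟩ := hx n
  exact ⟨⟨(i, j), hij⟩, by rw [h]⟩

end Gasket

end SierpinskiGasket

theorem mainTheorem4 (m : ℕ) (x : (n : ℕ) → SierpinskiGasket.Vertex (n + m + 1))
    (hx : ∀ n, x n = SierpinskiGasket.vertexA n m ∨ x n = SierpinskiGasket.vertexB n m ∨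
      x n = SierpinskiGasket.vertexC n m) :
    Tendsto (fun n : ℕ => SierpinskiGasket.degProb 1 (n + m + 1) (x n)) atTop (𝓝 0) ∧
    Tendsto (fun n : ℕ => SierpinskiGasket.degProb 2 (n + m + 1) (x n)) atTop
      (𝓝 (121 / 196)) ∧
    Tendsto (fun n : ℕ => SierpinskiGasket.degProb 3 (n + m + 1) (x n)) atTop
      (𝓝 (33 / 98)) ∧
    Tendsto (fun n : ℕ => SierpinskiGasket.degProb 4 (n + m + 1) (x n)) atTop
      (𝓝 (9 / 196)) := by
  have hmeeting (n : ℕ) : ∃ i j, i ≠ j ∧ x n = SierpinskiGasket.meetingVertex n i j m := by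
    rcases hx n with h | h | h
    · exact ⟨0, 1, by decide, h.trans (SierpinskiGasket.vertexA_eq_meetingVertex n m)⟩
    · exact ⟨0, 2, by decide, h.trans (SierpinskiGasket.vertexB_eq_meetingVertex n m)⟩
    · exact ⟨1, 2, by decide, h.trans (SierpinskiGasket.vertexC_eq_meetingVertex n m)⟩
  have hlim := SierpinskiGasket.tendsto_degProb_of_exists_eq_meetingVertex hmeeting
  have hlaw : SierpinskiGasket.meetingLaw 1 = 0 ∧ SierpinskiGasket.meetingLaw 2 = 121 / 196 ∧
      SierpinskiGasket.meetingLaw 3 = 33 / 98 ∧ SierpinskiGasket.meetingLaw 4 = 9 / 196 := by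
    norm_num [SierpinskiGasket.meetingLaw, SierpinskiGasket.cornerLaw,
      Finset.Nat.antidiagonal_succ]
  obtain ⟨h₁, h₂, h₃, h₄⟩ := hlaw
  exact ⟨h₁ ▸ hlim 1, h₂ ▸ hlim 2, h₃ ▸ hlim 3, h₄ ▸ hlim 4⟩
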